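/- Let $P$ be a finite poset with $n$ elements. A permutation on $P$ is a bijection $\sigma\colon\{1,\dots,n\}\to P$, written as the list $(\sigma_1,\dots,\sigma_n)$. We say that $\sigma$ contains the pattern $123$ if there are positions $i<j<k$ with $\sigma_i<\sigma_j<\sigma_k$ in $P$, and that it contains the pattern $132$ if there are positions $i<j<k$ with $\sigma_i<\sigma_k<\sigma_j$ in $P$; otherwise $\sigma$ avoids the pattern. Let $Av_P(\pi)$ denote the number of permutations on $P$ that avoid the pattern $\pi$. **Theorem.** For every finite poset $P$, $$Av_P(132)\le Av_P(123).$$ The inequality is strict if and only if $P$ contains at least one of the following three posets on the five-element set $\{a,b,c,d,e\}$ as an induced subposet, where each poset is given by its covering relations: - $Q_1$: $d<a<c$ and $e<b<c$; - $Q_2$: $d<a<c$, $e<b<c$ and $e<a$; - $Q_3$: $e<d<a<c$ and $e<b<c$. (An induced subposet of $P$ isomorphic to $Q$ is the image of a map $f\colon Q\to P$ such that $x\le y$ if and only if $f(x)\le f(y)$.) -/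

import Mathlib

/-- The permutation `σ` (the list `σ 0, σ 1, …, σ (n - 1)` of all elements of the poset `P`)
contains the pattern `π` (a list of all elements of the poset `Q`): there are positions
`i 0 < i 1 < ⋯ < i (k - 1)` such that for all `s < t` the order relation (`<`, `>` or
incomparable) between `σ (i s)` and `σ (i t)` is the one between `π s` and `π t`.
Distinct entries of a permutation are distinct elements, so the relation is "incomparable"
exactly when it is neither `<` nor `>`. -/
def PosetPerm.Contains {P Q : Type*} [PartialOrder P] [PartialOrder Q] {n k : ℕ}
    (σ : Fin n ≃ P) (π : Fin k ≃ Q) : Prop :=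
  ∃ i : Fin k → Fin n, StrictMono i ∧ ∀ s t : Fin k, s < t →
    ((σ (i s) < σ (i t) ↔ π s < π t) ∧ (σ (i t) < σ (i s) ↔ π t < π s))

/-- `σ` avoids the pattern `π`. -/
def PosetPerm.Avoids {P Q : Type*} [PartialOrder P] [PartialOrder Q] {n k : ℕ}
    (σ : Fin n ≃ P) (π : Fin k ≃ Q) : Prop :=
  ¬ PosetPerm.Contains σ π

/-- `Av_P(π)`: the number of permutations on the finite poset `P`, that is, of bijections from
`{0, …, |P| - 1}` to `P`, that avoid the pattern `π`. -/
noncomputable def PosetPerm.Av (P : Type*) [PartialOrder P] {Q : Type*} [PartialOrder Q] {k : ℕ}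
    (π : Fin k ≃ Q) : ℕ :=
  Nat.card {σ : Fin (Nat.card P) ≃ P // PosetPerm.Avoids σ π}

/-- The pattern `123` on the three-element chain (with entries `0, 1, 2`). -/
def PosetPerm.pat123 : Fin 3 ≃ Fin 3 := Equiv.refl (Fin 3)

/-- The pattern `132` on the three-element chain (with entries `0, 2, 1`). -/
def PosetPerm.pat132 : Fin 3 ≃ Fin 3 := Equiv.swap 1 2

/-- The common underlying set of the three posets `Q₁`, `Q₂`, `Q₃`. -/
inductive PosetPerm.Five : Type
  | a | b | c | d | e
  deriving DecidableEq

instance PosetPerm.instFintypeFive : Fintype PosetPerm.Five where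
  elems := {.a, .b, .c, .d, .e}
  complete x := by cases x <;> decide

/-- The poset `Q₁`, with covering relations `d < a < c` and `e < b < c`. -/
def PosetPerm.Q₁ : Type := PosetPerm.Five

/-- The poset `Q₂`, with covering relations `d < a < c`, `e < b < c` and `e < a`. -/
def PosetPerm.Q₂ : Type := PosetPerm.Five

/-- The poset `Q₃`, with covering relations `e < d < a < c` and `e < b < c`. -/
def PosetPerm.Q₃ : Type := PosetPerm.Five

/-- The strict order of `Q₁`, pair by pair. -/
def PosetPerm.lt₁ : List (PosetPerm.Five × PosetPerm.Five) :=
  [(.d, .a), (.d, .c), (.a, .c), (.e, .b), (.e, .c), (.b, .c)]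

/-- The strict order of `Q₂`, pair by pair. -/
def PosetPerm.lt₂ : List (PosetPerm.Five × PosetPerm.Five) :=
  [(.d, .a), (.d, .c), (.a, .c), (.e, .b), (.e, .c), (.b, .c), (.e, .a)]

/-- The strict order of `Q₃`, pair by pair. -/
def PosetPerm.lt₃ : List (PosetPerm.Five × PosetPerm.Five) :=
  [(.d, .a), (.d, .c), (.a, .c), (.e, .b), (.e, .c), (.b, .c), (.e, .a), (.e, .d)]

instance PosetPerm.instPartialOrderQ₁ : PartialOrder PosetPerm.Q₁ where
  le (x y : PosetPerm.Five) := x = y ∨ (x, y) ∈ PosetPerm.lt₁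
  le_refl _ := Or.inl rfl
  le_trans := by
    have h : ∀ x y z : PosetPerm.Five, (x = y ∨ (x, y) ∈ PosetPerm.lt₁) →
        (y = z ∨ (y, z) ∈ PosetPerm.lt₁) → (x = z ∨ (x, z) ∈ PosetPerm.lt₁) := by decide
    exact h
  le_antisymm := by
    have h : ∀ x y : PosetPerm.Five, (x = y ∨ (x, y) ∈ PosetPerm.lt₁) →
        (y = x ∨ (y, x) ∈ PosetPerm.lt₁) → x = y := by decide
    exact h

instance PosetPerm.instPartialOrderQ₂ : PartialOrder PosetPerm.Q₂ where
  le (x y : PosetPerm.Five) := x = y ∨ (x, y) ∈ PosetPerm.lt₂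
  le_refl _ := Or.inl rfl
  le_trans := by
    have h : ∀ x y z : PosetPerm.Five, (x = y ∨ (x, y) ∈ PosetPerm.lt₂) →
        (y = z ∨ (y, z) ∈ PosetPerm.lt₂) → (x = z ∨ (x, z) ∈ PosetPerm.lt₂) := by decide
    exact h
  le_antisymm := by
    have h : ∀ x y : PosetPerm.Five, (x = y ∨ (x, y) ∈ PosetPerm.lt₂) →
        (y = x ∨ (y, x) ∈ PosetPerm.lt₂) → x = y := by decide
    exact h

instance PosetPerm.instPartialOrderQ₃ : PartialOrder PosetPerm.Q₃ where
  le (x y : PosetPerm.Five) := x = y ∨ (x, y) ∈ PosetPerm.lt₃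
  le_refl _ := Or.inl rfl
  le_trans := by
    have h : ∀ x y z : PosetPerm.Five, (x = y ∨ (x, y) ∈ PosetPerm.lt₃) →
        (y = z ∨ (y, z) ∈ PosetPerm.lt₃) → (x = z ∨ (x, z) ∈ PosetPerm.lt₃) := by decide
    exact h
  le_antisymm := by
    have h : ∀ x y : PosetPerm.Five, (x = y ∨ (x, y) ∈ PosetPerm.lt₃) →
        (y = x ∨ (y, x) ∈ PosetPerm.lt₃) → x = y := by decide
    exact h

/-- `P` contains `Q` as an induced subposet: some map `Q → P` preserves and reflects the order
(hence is injective). -/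
def PosetPerm.HasInduced (P Q : Type*) [PartialOrder P] [PartialOrder Q] : Prop :=
  Nonempty (Q ↪o P)

/-!
Call an entry of a permutation released if some earlier entry is below it. From right to left, let
each released entry `x` slide through the part to its right: reading that part backwards, the
travelling entry is exchanged with every larger one it meets, and whatever travels at the end is
put in the place of `x`. Only released entries ever move, each to a place that is still above an
earlier entry, so the left-to-right minima stay fixed.

If the permutation avoids `132`, then `x` is minimal among the released entries to its right. Under
this condition a slide can be undone from left to right, by exchanging the travelling entry with
every smaller released one it meets, so rearranging is injective, and its values avoid `123`.
Conversely, undoing a slide in a `123`-avoider creates a `123` only if an entry `c` travels past a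
`b < c`, since `b` is released merely by an entry behind the place of the slide, and an entry
`a < c` with `b ≮ a` comes out in the end. If `d` and `e` release `a` and `b`, this amounts to
`d < a < c`, `e < b < c`, `d ≮ b` and `b ≮ a`, which is `Q₁`, `Q₂` or `Q₃` according to the
relations of `e` with `a` and `d`.
-/

namespace PosetPerm

/-- Two three-element chains `d < a < c` and `e < b < c` with a common top, subject to the two
non-relations that are shared by `Q₁`, `Q₂` and `Q₃` and force the remaining ones up to the
relations between `e` and `a`, `d`. -/
def HasTwinChains (P : Type*) [Preorder P] : Prop :=
  ∃ a b c d e : P, d < a ∧ a < c ∧ e < b ∧ b < c ∧ ¬ d < b ∧ ¬ b < a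

theorem insert_union_setOf_mem {α : Type*} (S : Set α) (a : α) (p : List α) :
    insert a S ∪ {x | x ∈ p} = S ∪ {x | x ∈ a :: p} := by
  ext x
  simp only [Set.mem_union, Set.mem_insert_iff, Set.mem_ofPred_eq, List.mem_cons]
  tauto

/-- `l` is a permutation of `P` in one-line notation: every element occurs exactly once. -/
def IsListing {P : Type*} (l : List P) : Prop :=
  l.Nodup ∧ ∀ x, x ∈ l

section Preorder

variable {P : Type*} [Preorder P] {S T V : Set P} {a b c x y z : P} {l m : List P}

/-- The elements above some element of `S`. With `S` the set of entries placed so far, an entry of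
a permutation is a left-to-right minimum exactly when it is not released. -/
def Released (S : Set P) : Set P :=
  {r | ∃ s ∈ S, s < r}

theorem isUpperSet_released (S : Set P) : IsUpperSet (Released S) :=
  fun _ _ hxy ⟨s, hs, hsx⟩ => ⟨s, hs, hsx.trans_le hxy⟩

theorem released_mono (h : S ⊆ T) : Released S ⊆ Released T :=
  fun _ ⟨s, hs, hsx⟩ => ⟨s, h hs, hsx⟩

theorem released_empty : Released (∅ : Set P) = ∅ := by
  simp [Released]

theorem mem_released_insert : x ∈ Released (insert a S) ↔ a < x ∨ x ∈ Released S := by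
  simp [Released]

theorem released_insert_of_mem (ha : a ∈ Released S) : Released (insert a S) = Released S := by
  ext x
  rw [mem_released_insert, or_iff_right_iff_imp]
  exact fun hax => isUpperSet_released S hax.le ha

/-- The list `l` has no `123` pattern, not even one whose first entry comes from `S`: this is what
it means for a `123`-avoiding permutation to continue with `l` after the entries in `S`. -/
def Avoids123After (S : Set P) (l : List P) : Prop :=
  l.Pairwise (fun b c => b ∈ Released S → ¬ b < c) ∧ l.Triplewise (fun a b c => a < b → ¬ b < c)

/-- The analogue of `Avoids123After` for the pattern `132`. -/
def Avoids132After (S : Set P) (l : List P) : Prop :=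
  l.Pairwise (fun b c => c ∈ Released S → ¬ c < b) ∧ l.Triplewise (fun a b c => a < c → ¬ c < b)

theorem avoids123After_nil : Avoids123After S [] :=
  ⟨.nil, .nil⟩

theorem avoids132After_nil : Avoids132After S [] :=
  ⟨.nil, .nil⟩

theorem avoids123After_cons : Avoids123After S (a :: l) ↔
    (a ∈ Released S → ∀ c ∈ l, ¬ a < c) ∧ Avoids123After (insert a S) l := by
  simp only [Avoids123After, List.pairwise_cons, List.triplewise_cons, mem_released_insert,
    or_imp, List.pairwise_and_iff]
  tauto

theorem avoids132After_cons : Avoids132After S (a :: l) ↔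
    (∀ c ∈ l, c ∈ Released S → ¬ c < a) ∧ Avoids132After (insert a S) l := by
  simp only [Avoids132After, List.pairwise_cons, List.triplewise_cons, mem_released_insert,
    or_imp, List.pairwise_and_iff]
  tauto

theorem avoids123After_insert_of_mem (ha : a ∈ Released S) :
    Avoids123After (insert a S) l ↔ Avoids123After S l := by
  rw [Avoids123After, released_insert_of_mem ha, Avoids123After]

theorem avoids123After_cons_of_mem (ha : a ∈ Released S) :
    Avoids123After S (a :: l) ↔ (∀ c ∈ l, ¬ a < c) ∧ Avoids123After S l := by
  rw [avoids123After_cons, avoids123After_insert_of_mem ha, forall_prop_of_true ha]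

theorem avoids123After_cons_of_notMem (ha : a ∉ Released S) :
    Avoids123After S (a :: l) ↔ Avoids123After (insert a S) l := by
  rw [avoids123After_cons, and_iff_right fun h => absurd h ha]

open Classical in
/-- Put `x` in front of `l` and let it travel: reading `l` from right to left, the travelling entry
is exchanged with every larger entry it meets, and the entry travelling at the end becomes the head
of the result. -/
noncomputable def slideIn (x : P) : List P → List P
  | [] => [x]
  | z :: l =>
    match slideIn x l with
    | [] => [z]
    | c :: m => if c < z then z :: c :: m else c :: z :: m

open Classical in
theorem slideIn_cons (h : slideIn x l = c :: m) :
    slideIn x (z :: l) = if c < z then z :: c :: m else c :: z :: m := by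
  rw [slideIn, h]

theorem exists_slideIn_eq_cons (x : P) (l : List P) : ∃ c m, slideIn x l = c :: m ∧ x ≤ c := by
  induction l with
  | nil => exact ⟨x, [], rfl, le_rfl⟩
  | cons z l ih =>
    obtain ⟨c, m, h, hxc⟩ := ih
    rw [slideIn_cons h]
    split_ifs with hcz
    · exact ⟨z, c :: m, rfl, hxc.trans hcz.le⟩
    · exact ⟨c, z :: m, rfl, hxc⟩

theorem le_of_slideIn_eq_cons (h : slideIn x l = c :: m) : x ≤ c := by
  obtain ⟨c', m', h', hxc⟩ := exists_slideIn_eq_cons x l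
  obtain ⟨rfl, rfl⟩ := List.cons_eq_cons.1 (h.symm.trans h')
  exact hxc

theorem slideIn_perm (x : P) (l : List P) : (slideIn x l).Perm (x :: l) := by
  induction l with
  | nil => rfl
  | cons z l ih =>
    obtain ⟨c, m, h, -⟩ := exists_slideIn_eq_cons x l
    have hz : (z :: c :: m).Perm (x :: z :: l) := ((h ▸ ih).cons z).trans (.swap x z l)
    rw [slideIn_cons h]
    split_ifs
    · exact hz
    · exact (List.Perm.swap z c m).trans hz

theorem not_lt_head_slideIn (h : slideIn x l = c :: m) (hx : ¬ z < x) (hz : ∀ u ∈ l, ¬ z < u) :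
    ¬ z < c := by
  have hc : c ∈ x :: l := (slideIn_perm x l).subset (h ▸ List.mem_cons_self)
  rcases List.mem_cons.1 hc with rfl | hc
  · exact hx
  · exact hz c hc

/-- Everything in the tail of the slide comes from `l`, except that `x` may have replaced the
larger element `c`. -/
theorem not_lt_of_mem_tail_slideIn (h : slideIn x l = c :: m) (hz : ∀ u ∈ l, ¬ z < u) :
    ∀ u ∈ m, ¬ z < u := by
  intro u hu hzu
  have hperm : (c :: m).Perm (x :: l) := h ▸ slideIn_perm x l
  have hul : u ∉ l := fun hul => hz u hul hzu
  obtain rfl : u = x := by simpa [hul] using hperm.subset (List.mem_cons_of_mem c hu)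
  rcases List.mem_cons.1 (hperm.subset List.mem_cons_self) with rfl | hc
  · exact hul (hperm.cons_inv.subset hu)
  · exact hz c hc (hzu.trans_le (le_of_slideIn_eq_cons h))

theorem slideIn_avoids123After (hx : x ∈ Released S) (hl : Avoids123After S l) :
    Avoids123After S (slideIn x l) := by
  induction l generalizing S with
  | nil => exact (avoids123After_cons_of_mem hx).2 ⟨by simp, hl⟩
  | cons z l ih =>
    obtain ⟨hz, hl⟩ := avoids123After_cons.1 hl
    obtain ⟨c, m, h, hxc⟩ := exists_slideIn_eq_cons x l
    have hc : c ∈ Released S := isUpperSet_released S hxc hx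
    have ih := h ▸ ih (released_mono (Set.subset_insert z S) hx) hl
    have htail (hz' : z ∈ Released S) : ∀ u ∈ m, ¬ z < u := not_lt_of_mem_tail_slideIn h (hz hz')
    rw [slideIn_cons h]
    split_ifs with hcz
    · exact avoids123After_cons.2
        ⟨fun hz' => List.forall_mem_cons.2 ⟨hcz.not_gt, htail hz'⟩, ih⟩
    · obtain ⟨hcm, hm⟩ :=
        (avoids123After_cons_of_mem (released_mono (Set.subset_insert z S) hc)).1 ih
      exact (avoids123After_cons_of_mem hc).2
        ⟨List.forall_mem_cons.2 ⟨hcz, hcm⟩, avoids123After_cons.2 ⟨htail, hm⟩⟩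

theorem eq_of_slideIn_eq (hV : IsUpperSet V) (hx : x ∈ V) (hy : y ∈ V)
    (hxl : ∀ z ∈ l, z ∈ V → ¬ z < x) (hym : ∀ z ∈ m, z ∈ V → ¬ z < y)
    (hl : l.Pairwise fun b c => b ∈ V → ¬ b < c) (hm : m.Pairwise fun b c => b ∈ V → ¬ b < c)
    (h : slideIn x l = slideIn y m) : x = y ∧ l = m := by
  have hlen : l.length = m.length := by
    simpa [(slideIn_perm _ _).length_eq] using congrArg List.length h
  induction l generalizing m with
  | nil =>
    obtain rfl := List.eq_nil_of_length_eq_zero hlen.symm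
    exact ⟨List.head_eq_of_cons_eq h, rfl⟩
  | cons z l ih =>
    obtain ⟨w, m, rfl⟩ := List.exists_cons_of_length_eq_add_one hlen.symm
    rw [List.forall_mem_cons] at hxl hym
    rw [List.pairwise_cons] at hl hm
    obtain ⟨c, k, hc, hxc⟩ := exists_slideIn_eq_cons x l
    obtain ⟨d, k', hd, hyd⟩ := exists_slideIn_eq_cons y m
    have hzc (hz : z ∈ V) : ¬ z < c :=
      not_lt_head_slideIn hc (hxl.1 hz) fun u hu => hl.1 u hu hz
    have hwd (hw : w ∈ V) : ¬ w < d :=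
      not_lt_head_slideIn hd (hym.1 hw) fun u hu => hm.1 u hu hw
    have ih := ih hxl.2 hym.2 hl.2 hm.2
    rw [hc, hd] at ih
    rw [slideIn_cons hc, slideIn_cons hd] at h
    split_ifs at h with hcz hdw hdw
    · grind
    · obtain ⟨rfl, rfl, -⟩ : z = d ∧ c = w ∧ k = k' := by simpa using h
      exact absurd hcz (hwd (hV hxc hx))
    · obtain ⟨rfl, rfl, -⟩ : c = w ∧ z = d ∧ k = k' := by simpa using h
      exact absurd hdw (hzc (hV hyd hy))
    · grind

theorem hasTwinChains_of_released (ha : a ∈ Released S) (hb : b ∈ Released T)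
    (hbS : b ∉ Released S) (hac : a < c) (hbc : b < c) (hba : ¬ b < a) : HasTwinChains P := by
  obtain ⟨d, hdS, hda⟩ := ha
  obtain ⟨e, -, heb⟩ := hb
  exact ⟨a, b, c, d, e, hda, hac, heb, hbc, fun hdb => hbS ⟨d, hdS, hdb⟩, hba⟩

theorem exists_slideIn_eq (hP : ¬ HasTwinChains P) (hST : S ⊆ T) (hy : y ∈ Released S)
    (hm : Avoids123After T (y :: m)) :
    ∃ x l, slideIn x l = y :: m ∧ x ∈ Released S ∧ (∀ z ∈ l, z ∈ Released S → ¬ z < x) ∧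
      Avoids123After T l := by
  induction m generalizing y T with
  | nil => exact ⟨y, [], rfl, hy, by simp, avoids123After_nil⟩
  | cons z m ih =>
    have hyT := released_mono hST hy
    obtain ⟨hyzm, hzm⟩ := (avoids123After_cons_of_mem hyT).1 hm
    obtain ⟨hyz, hym⟩ := List.forall_mem_cons.1 hyzm
    -- The travelling entry is exchanged here precisely if `z` is both smaller and released by `S`.
    by_cases hzy : z ∈ Released S ∧ z < y
    · obtain ⟨x, l, h, hx, hxl, hl⟩ := ih hST hzy.1 hzm
      have hperm : (z :: m).Perm (x :: l) := h ▸ slideIn_perm x l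
      have hxy : x < y := (le_of_slideIn_eq_cons h).trans_lt hzy.2
      refine ⟨x, y :: l, by rw [slideIn_cons h, if_pos hzy.2], hx,
        List.forall_mem_cons.2 ⟨fun _ => hxy.not_gt, hxl⟩,
        (avoids123After_cons_of_mem hyT).2 ⟨fun u hu => hyzm u ?_, hl⟩⟩
      exact hperm.mem_iff.2 (List.mem_cons_of_mem x hu)
    · obtain ⟨hz, hm⟩ := avoids123After_cons.1 hzm
      have hTz := Set.subset_insert z T
      obtain ⟨x, l, h, hx, hxl, hl⟩ := ih (hST.trans hTz) hy
        ((avoids123After_cons_of_mem (released_mono hTz hyT)).2 ⟨hym, hm⟩)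
      have hxy := le_of_slideIn_eq_cons h
      refine ⟨x, z :: l, by rw [slideIn_cons h, if_neg hyz], hx,
        List.forall_mem_cons.2 ⟨fun hzS hzx => hzy ⟨hzS, hzx.trans_le hxy⟩, hxl⟩,
        avoids123After_cons.2 ⟨fun hzT u hu hzu => ?_, hl⟩⟩
      have hperm : (y :: m).Perm (x :: l) := h ▸ slideIn_perm x l
      have hum : u ∉ m := fun hum => hz hzT u hum hzu
      obtain rfl : u = y := by
        simpa [hum] using hperm.mem_iff.2 (List.mem_cons_of_mem x hu)
      have hxm : x ∈ m := by
        rcases List.mem_cons.1 (hperm.mem_iff.2 List.mem_cons_self) with rfl | hxm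
        · exact absurd (hperm.cons_inv.mem_iff.2 hu) hum
        · exact hxm
      have hzx : ¬ z < x := hz hzT x hxm
      exact hP (hasTwinChains_of_released hx hzT (fun hzS => hzy ⟨hzS, hzu⟩)
        (hxy.lt_of_not_ge fun hux => hzx (hzu.trans_le hux)) hzu hzx)

open Classical in
/-- Slide in the entries of `l` from the last to the first, except for those that are not above an
earlier entry (from `S` or `l`), which stay in place. -/
noncomputable def rearrange : Set P → List P → List P
  | _, [] => []
  | S, a :: l =>
    if a ∈ Released S then slideIn a (rearrange (insert a S) l) else a :: rearrange (insert a S) l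

theorem rearrange_cons_of_mem (ha : a ∈ Released S) :
    rearrange S (a :: l) = slideIn a (rearrange (insert a S) l) :=
  if_pos ha

theorem rearrange_cons_of_notMem (ha : a ∉ Released S) :
    rearrange S (a :: l) = a :: rearrange (insert a S) l :=
  if_neg ha

theorem rearrange_perm (S : Set P) (l : List P) : (rearrange S l).Perm l := by
  induction l generalizing S with
  | nil => rfl
  | cons a l ih =>
    by_cases ha : a ∈ Released S
    · rw [rearrange_cons_of_mem ha]
      exact (slideIn_perm a _).trans ((ih _).cons a)
    · rw [rearrange_cons_of_notMem ha]
      exact (ih _).cons a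

theorem Avoids132After.avoids123After_rearrange (h : Avoids132After S l) :
    Avoids123After S (rearrange S l) := by
  induction l generalizing S with
  | nil => exact avoids123After_nil
  | cons a l ih =>
    have hl := ih (avoids132After_cons.1 h).2
    by_cases ha : a ∈ Released S
    · rw [rearrange_cons_of_mem ha]
      exact slideIn_avoids123After ha ((avoids123After_insert_of_mem ha).1 hl)
    · rw [rearrange_cons_of_notMem ha]
      exact (avoids123After_cons_of_notMem ha).2 hl

theorem exists_rearrange_eq_cons_of_mem (ha : a ∈ Released S) (l : List P) :
    ∃ c ∈ Released S, ∃ m, rearrange S (a :: l) = c :: m := by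
  rw [rearrange_cons_of_mem ha]
  obtain ⟨c, m, h, hac⟩ := exists_slideIn_eq_cons a (rearrange (insert a S) l)
  exact ⟨c, isUpperSet_released S hac ha, m, h⟩

theorem exists_eq_cons_of_rearrange_eq_cons (ha : a ∉ Released S)
    (h : rearrange S l = a :: m) : ∃ k, l = a :: k ∧ rearrange (insert a S) k = m := by
  cases l with
  | nil => cases h
  | cons x k =>
    by_cases hx : x ∈ Released S
    · obtain ⟨c, hc, k', hk'⟩ := exists_rearrange_eq_cons_of_mem hx k
      exact absurd (List.head_eq_of_cons_eq (hk'.symm.trans h) ▸ hc) ha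
    · rw [rearrange_cons_of_notMem hx] at h
      obtain ⟨rfl, rfl⟩ := List.cons_eq_cons.1 h
      exact ⟨k, rfl, rfl⟩

theorem exists_eq_cons_of_rearrange_eq_slideIn (hl : Avoids132After S l) (ha : a ∈ Released S)
    (ham : ∀ z ∈ m, z ∈ Released S → ¬ z < a)
    (hm : m.Pairwise fun b c => b ∈ Released S → ¬ b < c) (h : rearrange S l = slideIn a m) :
    ∃ k, l = a :: k ∧ rearrange (insert a S) k = m := by
  cases l with
  | nil =>
    obtain ⟨c, m', hc, -⟩ := exists_slideIn_eq_cons a m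
    cases h.trans hc
  | cons x k =>
    obtain ⟨hxk, hk⟩ := avoids132After_cons.1 hl
    by_cases hx : x ∈ Released S
    · rw [rearrange_cons_of_mem hx] at h
      obtain ⟨rfl, rfl⟩ := eq_of_slideIn_eq (isUpperSet_released S) hx ha
        (fun z hz => hxk z ((rearrange_perm _ _).mem_iff.1 hz)) ham
        ((avoids123After_insert_of_mem hx).1 hk.avoids123After_rearrange).1 hm h
      exact ⟨k, rfl, rfl⟩
    · obtain ⟨c, m', hc, hac⟩ := exists_slideIn_eq_cons a m
      rw [rearrange_cons_of_notMem hx, hc] at h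
      exact absurd (List.head_eq_of_cons_eq h ▸ isUpperSet_released S hac ha) hx

theorem eq_of_rearrange_eq (hl : Avoids132After S l) (hm : Avoids132After S m)
    (h : rearrange S l = rearrange S m) : l = m := by
  induction m generalizing S l with
  | nil => exact (h ▸ rearrange_perm S l).symm.eq_nil
  | cons a m ih =>
    obtain ⟨ham, hm⟩ := avoids132After_cons.1 hm
    suffices ∃ k, l = a :: k ∧ rearrange (insert a S) k = rearrange (insert a S) m by
      obtain ⟨k, rfl, hk⟩ := this
      rw [ih (avoids132After_cons.1 hl).2 hm hk]
    by_cases ha : a ∈ Released S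
    · rw [rearrange_cons_of_mem ha] at h
      exact exists_eq_cons_of_rearrange_eq_slideIn hl ha
        (fun z hz => ham z ((rearrange_perm _ _).mem_iff.1 hz))
        ((avoids123After_insert_of_mem ha).1 hm.avoids123After_rearrange).1 h
    · rw [rearrange_cons_of_notMem ha] at h
      exact exists_eq_cons_of_rearrange_eq_cons ha h

theorem exists_rearrange_eq (hP : ¬ HasTwinChains P) (hm : Avoids123After S m) :
    ∃ l, Avoids132After S l ∧ rearrange S l = m := by
  induction hn : m.length generalizing S m with
  | zero =>
    obtain rfl := List.eq_nil_of_length_eq_zero hn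
    exact ⟨[], avoids132After_nil, rfl⟩
  | succ n ih =>
    obtain ⟨y, m, rfl⟩ := List.exists_cons_of_length_eq_add_one hn
    by_cases hy : y ∈ Released S
    · obtain ⟨x, k, hxk, hx, hmin, hk⟩ := exists_slideIn_eq hP subset_rfl hy hm
      have hlen : (x :: k).length = n + 1 := by rw [← hn, ← hxk, (slideIn_perm x k).length_eq]
      obtain ⟨l, hl, rfl⟩ :=
        ih ((avoids123After_insert_of_mem hx).2 hk) (Nat.succ_injective hlen)
      refine ⟨x :: l, avoids132After_cons.2 ⟨fun z hz => hmin z ?_, hl⟩, ?_⟩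
      · exact (rearrange_perm _ _).mem_iff.2 hz
      · rw [rearrange_cons_of_mem hx, hxk]
    · obtain ⟨l, hl, rfl⟩ :=
        ih ((avoids123After_cons_of_notMem hy).1 hm) (Nat.succ_injective hn)
      refine ⟨y :: l, avoids132After_cons.2 ⟨fun z _ hzS hzy => ?_, hl⟩, ?_⟩
      · exact hy (isUpperSet_released S hzy.le hzS)
      · rw [rearrange_cons_of_notMem hy]

theorem avoids123After_append {p q : List P} (hpS : ∀ x ∈ p, x ∉ Released S)
    (hp : p.Pairwise fun x y => ¬ x < y) :
    Avoids123After S (p ++ q) ↔ Avoids123After (S ∪ {x | x ∈ p}) q := by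
  induction p generalizing S with
  | nil => simp
  | cons a p ih =>
    obtain ⟨haS, hpS⟩ := List.forall_mem_cons.1 hpS
    obtain ⟨hap, hp⟩ := List.pairwise_cons.1 hp
    have hpaS : ∀ x ∈ p, x ∉ Released (insert a S) := fun x hx h =>
      (mem_released_insert.1 h).elim (hap x hx) (hpS x hx)
    rw [List.cons_append, avoids123After_cons_of_notMem haS, ih hpaS hp, insert_union_setOf_mem]

theorem exists_rearrange_eq_of_append {p q : List P} (hpS : ∀ x ∈ p, x ∉ Released S)
    (hp : p.Pairwise fun x y => ¬ x < y) (hl : Avoids132After S l) (h : rearrange S l = p ++ q) :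
    ∃ k, Avoids132After (S ∪ {x | x ∈ p}) k ∧ rearrange (S ∪ {x | x ∈ p}) k = q := by
  induction p generalizing S l with
  | nil => simpa using ⟨l, hl, h⟩
  | cons a p ih =>
    obtain ⟨haS, hpS⟩ := List.forall_mem_cons.1 hpS
    obtain ⟨hap, hp⟩ := List.pairwise_cons.1 hp
    obtain ⟨k, rfl, hk⟩ := exists_eq_cons_of_rearrange_eq_cons haS h
    have hpaS : ∀ x ∈ p, x ∉ Released (insert a S) := fun x hx h =>
      (mem_released_insert.1 h).elim (hap x hx) (hpS x hx)
    rw [← insert_union_setOf_mem]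
    exact ih hpaS hp (avoids132After_cons.1 hl).2 hk

theorem slideIn_append {p q : List P} (h : slideIn x q = c :: m) (hp : ∀ z ∈ p, ¬ c < z) :
    slideIn x (p ++ q) = c :: (p ++ m) := by
  induction p with
  | nil => exact h
  | cons z p ih =>
    obtain ⟨hz, hp⟩ := List.forall_mem_cons.1 hp
    rw [List.cons_append, slideIn_cons (ih hp), if_neg hz, List.cons_append]

theorem rearrange_ne_of_not_pairwise {p : List P} (ha : a ∈ Released S)
    (hpS : ∀ x ∈ p, x ∉ Released S) (hac : a < c)
    (hpc : ¬ p.Pairwise fun x y => x < y → ¬ y < c) (hl : Avoids132After S l) :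
    rearrange S l ≠ c :: (p ++ [a]) := by
  intro h
  have hc : c ∈ Released S := isUpperSet_released S hac.le ha
  have hslide : slideIn a (p ++ [c]) = c :: (p ++ [a]) := by
    have hac' : slideIn a [c] = [c, a] := by rw [slideIn_cons rfl, if_pos hac]
    exact slideIn_append hac' fun z hz hcz => hpS z hz (isUpperSet_released S hcz.le hc)
  have hmin : ∀ z ∈ p ++ [c], z ∈ Released S → ¬ z < a := by
    rw [List.forall_mem_append, List.forall_mem_singleton]
    exact ⟨fun z hz hzS => absurd hzS (hpS z hz), fun _ => hac.not_gt⟩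
  have htop : (p ++ [c]).Pairwise fun y z => y ∈ Released S → ¬ y < z :=
    List.pairwise_append.2
      ⟨List.pairwise_of_forall_mem_list fun y hy _ _ hyS => absurd hyS (hpS y hy),
        List.pairwise_singleton _ _, fun y hy _ _ hyS => absurd hyS (hpS y hy)⟩
  obtain ⟨k, rfl, hk⟩ :=
    exists_eq_cons_of_rearrange_eq_slideIn hl ha hmin htop (h.trans hslide.symm)
  have h123 := hk ▸ (avoids132After_cons.1 hl).2.avoids123After_rearrange
  exact hpc ((List.triplewise_append.1 h123.2).2.2.2 c (List.mem_singleton_self c))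

theorem exists_nodup_pairwise_not_lt (s : Finset P) :
    ∃ l : List P, l.Nodup ∧ (∀ x, x ∈ l ↔ x ∈ s) ∧ l.Pairwise fun x y => ¬ x < y := by
  classical
  induction s using Finset.strongInduction with
  | H s ih =>
    rcases s.eq_empty_or_nonempty with rfl | hs
    · exact ⟨[], by simp⟩
    · obtain ⟨a, ha, hmax⟩ := s.exists_maximal hs
      obtain ⟨l, hnodup, hmem, hl⟩ := ih _ (Finset.erase_ssubset ha)
      refine ⟨a :: l, List.nodup_cons.2 ⟨by simp [hmem], hnodup⟩, fun x => ?_,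
        List.pairwise_cons.2 ⟨fun x hx hax => ?_, hl⟩⟩
      · rw [List.mem_cons, hmem, ← Finset.mem_insert, Finset.insert_erase ha]
      · exact hax.not_ge (hmax (Finset.mem_of_mem_erase ((hmem x).1 hx)) hax.le)

theorem avoids123After_cons_append_pair {p : List P} (ha : a ∈ Released S) (hb : b ∉ Released S)
    (hac : a < c) (hbc : b < c) (hba : ¬ b < a) (hpb : ∀ x ∈ p, x < b)
    (hp : p.Pairwise fun x y => ¬ x < y) : Avoids123After S (c :: (p ++ [b, a])) := by
  have hpS : ∀ x ∈ p, x ∉ Released S := fun x hx hxS =>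
    hb (isUpperSet_released S (hpb x hx).le hxS)
  have hc : ∀ x ∈ p ++ [b, a], ¬ c < x := by
    rw [List.forall_mem_append]
    exact ⟨fun x hx => ((hpb x hx).trans hbc).not_gt, by simp [hac.not_gt, hbc.not_gt]⟩
  have hpair : Avoids123After (S ∪ {x | x ∈ p}) [b, a] := by simp [Avoids123After, hba]
  exact (avoids123After_cons_of_mem (isUpperSet_released S hac.le ha)).2
    ⟨hc, (avoids123After_append hpS hp).2 hpair⟩

-- The witness ends with `c`, the elements below `b`, `b` and `a`: the slide of `a` past `c` cannot
-- be undone without creating the pattern `e < b < c`.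
theorem HasTwinChains.exists_forall_rearrange_ne [Finite P] (h : HasTwinChains P) :
    ∃ m : List P, IsListing m ∧ Avoids123After ∅ m ∧
      ∀ l, Avoids132After ∅ l → rearrange ∅ l ≠ m := by
  classical
  have := Fintype.ofFinite P
  obtain ⟨a, b, c, d, e, hda, hac, heb, hbc, hdb, hba⟩ := h
  have hab : ¬ a < b := fun hab => hdb (hda.trans hab)
  have hne : a ≠ b := fun hne => hdb (hne ▸ hda)
  have hdb' : d ≠ b := fun hdb' => hba (hdb' ▸ hda)
  obtain ⟨p, hpnodup, hpb, hp⟩ := exists_nodup_pairwise_not_lt {x | x < b}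
  obtain ⟨q, hqnodup, hq, hqtop⟩ :=
    exists_nodup_pairwise_not_lt {x | x ≠ a ∧ x ≠ b ∧ x ≠ c ∧ ¬ x < b}
  simp only [Finset.mem_filter_univ] at hpb hq
  have hqS : ∀ x ∈ q, x ∉ Released ∅ := by simp [released_empty]
  have haS : a ∈ Released (∅ ∪ {x | x ∈ q}) :=
    ⟨d, .inr ((hq d).2 ⟨hda.ne, hdb', (hda.trans hac).ne, hdb⟩), hda⟩
  have hbS : b ∉ Released (∅ ∪ {x | x ∈ q}) := by
    rintro ⟨x, hx | hx, hxb⟩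
    · exact hx
    · exact ((hq x).1 hx).2.2.2 hxb
  have hpS : ∀ x ∈ p ++ [b], x ∉ Released (∅ ∪ {x | x ∈ q}) := by
    rw [List.forall_mem_append, List.forall_mem_singleton]
    exact ⟨fun x hx hxS => hbS (isUpperSet_released _ ((hpb x).1 hx).le hxS), hbS⟩
  refine ⟨q ++ c :: (p ++ [b, a]), ⟨?_, fun x => ?_⟩, (avoids123After_append hqS hqtop).2 <|
    avoids123After_cons_append_pair haS hbS hac hbc hba (fun x => (hpb x).1) hp, fun l hl h => ?_⟩
  · simp only [List.nodup_append, List.nodup_cons]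
    grind
  · grind
  · obtain ⟨k, hk, hkm⟩ := exists_rearrange_eq_of_append hqS hqtop hl h
    refine rearrange_ne_of_not_pairwise haS hpS hac (fun hpc => ?_) hk (by simpa using hkm)
    exact (List.pairwise_append.1 hpc).2.2 e ((hpb e).2 heb) b (List.mem_singleton_self b) heb hbc

end Preorder

section Permutations

theorem contains_iff_exists_strictMono {P Q : Type*} [PartialOrder P] [LinearOrder Q] {n k : ℕ}
    {σ : Fin n ≃ P} {π : Fin k ≃ Q} :
    Contains σ π ↔ ∃ i : Fin k → Fin n, StrictMono i ∧ StrictMono (σ ∘ i ∘ π.symm) := by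
  refine exists_congr fun i => and_congr_right fun _ => ⟨fun h q r hqr => ?_, fun h s t _ => ?_⟩
  · rcases lt_trichotomy (π.symm q) (π.symm r) with hs | hs | hs
    · exact (h _ _ hs).1.2 (by simpa using hqr)
    · exact absurd (π.symm.injective hs) hqr.ne
    · exact (h _ _ hs).2.2 (by simpa using hqr)
  · rcases lt_trichotomy (π s) (π t) with hst | hst | hst
    · have : σ (i s) < σ (i t) := by simpa using h hst
      exact ⟨iff_of_true this hst, iff_of_false this.not_gt hst.not_gt⟩
    · obtain rfl := π.injective hst
      simp
    · have : σ (i t) < σ (i s) := by simpa using h hst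
      exact ⟨iff_of_false this.not_gt hst.not_gt, iff_of_true this hst⟩

theorem avoids_fin_three_iff {P : Type*} [PartialOrder P] {n : ℕ} {σ : Fin n ≃ P}
    {π : Fin 3 ≃ Fin 3} : Avoids σ π ↔ (List.ofFn σ).Triplewise fun a b c =>
      ¬ StrictMono (![a, b, c] ∘ π.symm) := by
  simp only [Avoids, contains_iff_exists_strictMono, List.triplewise_iff_getElem,
    List.getElem_ofFn, List.length_ofFn]
  constructor
  · refine fun h i j k hij hjk hk hσ => h ⟨![⟨i, by lia⟩, ⟨j, by lia⟩, ⟨k, hk⟩], ?_, ?_⟩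
    · simpa using ⟨hij, hjk⟩
    · rwa [← Function.comp_assoc, ← FinVec.etaExpand_eq (σ ∘ _)]
  · rintro h ⟨i, hi, hσ⟩
    refine h (i 0) (i 1) (i 2) (hi (by decide)) (hi (by decide)) (i 2).2 ?_
    rwa [← Function.comp_assoc, ← FinVec.etaExpand_eq (σ ∘ i)] at hσ

theorem avoids_pat123_iff {P : Type*} [PartialOrder P] {n : ℕ} {σ : Fin n ≃ P} :
    Avoids σ pat123 ↔ Avoids123After ∅ (List.ofFn σ) := by
  rw [avoids_fin_three_iff, Avoids123After, released_empty]
  simp [pat123]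

theorem avoids_pat132_iff {P : Type*} [PartialOrder P] {n : ℕ} {σ : Fin n ≃ P} :
    Avoids σ pat132 ↔ Avoids132After ∅ (List.ofFn σ) := by
  have hswap (a b c : P) : ![a, b, c] ∘ pat132.symm = ![a, c, b] := by
    ext i
    fin_cases i <;> rfl
  rw [avoids_fin_three_iff, Avoids132After, released_empty]
  simp [hswap]

theorem IsListing.of_perm {P : Type*} {l m : List P} (hl : IsListing l) (h : m.Perm l) :
    IsListing m :=
  ⟨h.nodup_iff.2 hl.1, fun x => h.mem_iff.2 (hl.2 x)⟩

theorem isListing_ofFn {P : Type*} {n : ℕ} (σ : Fin n ≃ P) : IsListing (List.ofFn σ) :=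
  ⟨List.nodup_ofFn.2 σ.injective, fun x => List.mem_ofFn.2 (σ.surjective x)⟩

theorem IsListing.exists_ofFn_eq {P : Type*} {l : List P} (hl : IsListing l) :
    ∃ σ : Fin (Nat.card P) ≃ P, List.ofFn σ = l := by
  classical
  let e := hl.1.getEquivOfForallMemList l hl.2
  have hcard : Nat.card P = l.length := by rw [← Nat.card_congr e, Nat.card_fin]
  refine ⟨(finCongr hcard).trans e, List.ext_getElem (by simp [hcard]) fun i _ _ => ?_⟩
  simp [e]

theorem finite_setOf_isListing (P : Type*) : {l : List P | IsListing l}.Finite := by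
  refine (Set.finite_range fun σ : Fin (Nat.card P) ≃ P => List.ofFn σ).subset ?_
  exact fun l hl => hl.exists_ofFn_eq

theorem av_eq_ncard {P Q : Type*} [PartialOrder P] [PartialOrder Q] {k : ℕ} {π : Fin k ≃ Q}
    {A : List P → Prop} (hA : ∀ σ : Fin (Nat.card P) ≃ P, Avoids σ π ↔ A (List.ofFn σ)) :
    Av P π = {l | IsListing l ∧ A l}.ncard := by
  have hinj : Function.Injective fun σ : Fin (Nat.card P) ≃ P => List.ofFn σ :=
    List.ofFn_injective.comp DFunLike.coe_injective
  have himage : (fun σ : Fin (Nat.card P) ≃ P => List.ofFn σ) '' {σ | Avoids σ π} =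
      {l | IsListing l ∧ A l} := by
    ext l
    constructor
    · rintro ⟨σ, hσ, rfl⟩
      exact ⟨isListing_ofFn σ, (hA σ).1 hσ⟩
    · rintro ⟨hl, hlA⟩
      obtain ⟨σ, rfl⟩ := hl.exists_ofFn_eq
      exact ⟨σ, (hA σ).2 hlA, rfl⟩
  rw [← himage, Set.ncard_image_of_injective _ hinj]
  rfl

theorem av_pat123_eq_ncard (P : Type*) [PartialOrder P] :
    Av P pat123 = {l : List P | IsListing l ∧ Avoids123After ∅ l}.ncard :=
  av_eq_ncard fun _ => avoids_pat123_iff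

theorem ncard_rearrange_image (P : Type*) [PartialOrder P] :
    (rearrange ∅ '' {l : List P | IsListing l ∧ Avoids132After ∅ l}).ncard = Av P pat132 := by
  rw [av_eq_ncard fun _ => avoids_pat132_iff]
  exact Set.InjOn.ncard_image fun l hl m hm h => eq_of_rearrange_eq hl.2 hm.2 h

theorem rearrange_image_subset (P : Type*) [PartialOrder P] :
    rearrange ∅ '' {l : List P | IsListing l ∧ Avoids132After ∅ l} ⊆
      {m | IsListing m ∧ Avoids123After ∅ m} := by
  rintro _ ⟨l, ⟨hl, hl132⟩, rfl⟩
  exact ⟨hl.of_perm (rearrange_perm ∅ l), hl132.avoids123After_rearrange⟩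

theorem rearrange_image_eq_iff (P : Type*) [PartialOrder P] [Finite P] :
    rearrange ∅ '' {l : List P | IsListing l ∧ Avoids132After ∅ l} =
      {m | IsListing m ∧ Avoids123After ∅ m} ↔ ¬ HasTwinChains P := by
  constructor
  · intro h hP
    obtain ⟨m, hm, hm123, hne⟩ := hP.exists_forall_rearrange_ne
    obtain ⟨l, hl, rfl⟩ := h.ge ⟨hm, hm123⟩
    exact hne l hl.2 rfl
  · refine fun hP => (rearrange_image_subset P).antisymm fun m hm => ?_
    obtain ⟨l, hl, rfl⟩ := exists_rearrange_eq hP hm.2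
    exact ⟨l, ⟨hm.1.of_perm (rearrange_perm ∅ l).symm, hl⟩, rfl⟩

theorem av_pat132_le_av_pat123 (P : Type*) [PartialOrder P] : Av P pat132 ≤ Av P pat123 := by
  rw [← ncard_rearrange_image, av_pat123_eq_ncard]
  exact Set.ncard_le_ncard (rearrange_image_subset P)
    ((finite_setOf_isListing P).subset fun _ h => h.1)

theorem av_pat132_lt_av_pat123_iff (P : Type*) [PartialOrder P] [Finite P] :
    Av P pat132 < Av P pat123 ↔ HasTwinChains P := by
  rw [← not_iff_not, ← rearrange_image_eq_iff, ← ncard_rearrange_image, av_pat123_eq_ncard, not_lt]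
  refine ⟨fun h => Set.eq_of_subset_of_ncard_le (rearrange_image_subset P) h ?_, ?_⟩
  · exact (finite_setOf_isListing P).subset fun _ h => h.1
  · exact fun h => h ▸ le_rfl

end Permutations

section Configuration

theorem hasTwinChains_of_map_le_iff {P : Type*} [PartialOrder P] {f : Five → P}
    {r : List (Five × Five)} (hr : r ∈ [lt₁, lt₂, lt₃])
    (hf : ∀ x y, f x ≤ f y ↔ x = y ∨ (x, y) ∈ r) : HasTwinChains P := by
  refine ⟨f .a, f .b, f .c, f .d, f .e, ?_⟩
  simp only [lt_iff_le_not_ge, hf]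
  fin_cases hr <;> simp [lt₁, lt₂, lt₃]

theorem HasTwinChains.exists_map_le_iff {P : Type*} [PartialOrder P] (h : HasTwinChains P) :
    ∃ f : Five → P, ∀ x y, f x ≤ f y ↔ x = y ∨ (x, y) ∈ lt₁ ∨
      (x, y) = (.e, .a) ∧ f .e ≤ f .a ∨ (x, y) = (.e, .d) ∧ f .e ≤ f .d := by
  obtain ⟨a, b, c, d, e, hda, hac, heb, hbc, hdb, hba⟩ := h
  have hdc := hda.trans hac
  have hec := heb.trans hbc
  have hab : ¬ a ≤ b := fun h => hdb (hda.trans_le h)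
  have hba : ¬ b ≤ a := fun h => hba (h.lt_of_not_ge hab)
  have hbd : ¬ b ≤ d := fun h => hba (h.trans hda.le)
  have hde : ¬ d ≤ e := fun h => hdb (h.trans_lt heb)
  have hdb : ¬ d ≤ b := fun h => hdb (h.lt_of_not_ge hbd)
  have hae : ¬ a ≤ e := fun h => hab (h.trans heb.le)
  refine ⟨fun x => Five.rec a b c d e x, ?_⟩
  rintro (_ | _) (_ | _) <;>
    simp [lt₁, hab, hba, hbd, hde, hdb, hae, hda.le, hac.le, heb.le, hbc.le, hdc.le, hec.le,
      hda.not_ge, hac.not_ge, heb.not_ge, hbc.not_ge, hdc.not_ge, hec.not_ge]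

theorem HasTwinChains.hasInduced {P : Type*} [PartialOrder P] (h : HasTwinChains P) :
    HasInduced P Q₁ ∨ HasInduced P Q₂ ∨ HasInduced P Q₃ := by
  obtain ⟨f, hf⟩ := h.exists_map_le_iff
  have hda : f .d ≤ f .a := (hf _ _).2 (by simp [lt₁])
  by_cases hed : f .e ≤ f .d
  · have hea := hed.trans hda
    refine .inr (.inr ⟨OrderEmbedding.ofMapLEIff (α := Q₃) f fun x y => (hf x y).trans ?_⟩)
    exact or_congr_right (by simp [lt₁, lt₃, hed, hea, or_assoc])
  by_cases hea : f .e ≤ f .a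
  · refine .inr (.inl ⟨OrderEmbedding.ofMapLEIff (α := Q₂) f fun x y => (hf x y).trans ?_⟩)
    exact or_congr_right (by simp [lt₁, lt₂, hed, hea, or_assoc])
  · refine .inl ⟨OrderEmbedding.ofMapLEIff (α := Q₁) f fun x y => (hf x y).trans ?_⟩
    exact or_congr_right (by simp [hed, hea])

theorem hasTwinChains_iff (P : Type*) [PartialOrder P] :
    HasTwinChains P ↔ HasInduced P Q₁ ∨ HasInduced P Q₂ ∨ HasInduced P Q₃ := by
  refine ⟨HasTwinChains.hasInduced, ?_⟩
  rintro (⟨⟨f⟩⟩ | ⟨⟨f⟩⟩ | ⟨⟨f⟩⟩)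
  · exact hasTwinChains_of_map_le_iff (r := lt₁) (by simp) fun _ _ => f.le_iff_le
  · exact hasTwinChains_of_map_le_iff (r := lt₂) (by simp) fun _ _ => f.le_iff_le
  · exact hasTwinChains_of_map_le_iff (r := lt₃) (by simp) fun _ _ => f.le_iff_le

end Configuration

end PosetPerm

theorem mainTheorem1 (P : Type*) [PartialOrder P] [Finite P] :
    PosetPerm.Av P PosetPerm.pat132 ≤ PosetPerm.Av P PosetPerm.pat123 ∧
      (PosetPerm.Av P PosetPerm.pat132 < PosetPerm.Av P PosetPerm.pat123 ↔
        PosetPerm.HasInduced P PosetPerm.Q₁ ∨ PosetPerm.HasInduced P PosetPerm.Q₂ ∨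
          PosetPerm.HasInduced P PosetPerm.Q₃) := by
  exact ⟨PosetPerm.av_pat132_le_av_pat123 P,
    (PosetPerm.av_pat132_lt_av_pat123_iff P).trans (PosetPerm.hasTwinChains_iff P)⟩
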